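/- Let $k$ be a field that is complete with respect to a non-Archimedean absolute value $|\cdot|$, and suppose that $|k|=\{|x| : x\in k\}$ is dense in $[0,\infty)$. For a set $I$ and a Banach $k$-vector space $V$, let $\ell^\infty(I,V)$ be the space of bounded families $(v_i)_{i\in I}$ in $V$ with the supremum norm, and let $C_0(I,V)\subset \ell^\infty(I,V)$ be the closed subspace of the families such that $\{i\in I : \|v_i\|\ge\varepsilon\}$ is finite for every $\varepsilon>0$. Write $V\cong W$ if there is an isometric $k$-linear isomorphism from $V$ onto $W$. For an infinite cardinal $\lambda$ define $V_{t,n}$ for $t\in\{0,1\}$ and $n\ge 0$ recursively by $$V_{t,0}=k,\qquad V_{0,n}=\ell^\infty(\lambda,V_{1,n-1}),\qquad V_{1,n}=C_0(\lambda,V_{0,n-1})\qquad(n\ge 1).$$ (a) Let $\kappa$ be an infinite cardinal or the class of all ordinals, and suppose that no $\alpha\in\kappa$ is $\omega_1$-measurable, where a set is called $\omega_1$-measurable if it is uncountable and carries a non-principal ultrafilter that is closed under countable intersections. Let $\lambda\in\kappa$ be an infinite cardinal. Then for all $t,t'\in\{0,1\}$ and all $n,n'\ge 1$, $$V_{t,n}\cong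 V_{t',n'}\iff (t,n)=(t',n').$$ (b) In particular, for $\lambda=\omega$ the same equivalence holds with no assumption on measurable cardinals, i.e. the spaces $\ell^\infty(\mathbb N,k)$, $C_0(\mathbb N,k)$, $\ell^\infty(\mathbb N,C_0(\mathbb N,k))$, $C_0(\mathbb N,\ell^\infty(\mathbb N,k))$, $\ell^\infty(\mathbb N,C_0(\mathbb N,\ell^\infty(\mathbb N,k)))$, $\ldots$ are pairwise not isometrically isomorphic. -/

import Mathlib

open Cardinal Set
open scoped ENNReal NNReal

universe u

/-- A set `X` is `c`-measurable if it is uncountable and admits a `c`-complete non-principal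
ultrafilter, i.e. one that is closed under intersections of fewer than `c` members. -/
def IsMeasurableSet (c : Cardinal.{u}) (X : Type u) : Prop :=
  Uncountable X ∧
    ∃ F : Ultrafilter X, CardinalInterFilter (F : Filter X) c ∧ ∀ x : X, F ≠ pure x

/-- `κ` is a cardinal, or `⊤`, which stands for the class of all ordinals. It satisfies the
non-measurability condition if no set of cardinality in `κ` is `ℵ₁`-measurable. -/
def NonMeasurabilityCondition (κ : WithTop Cardinal.{u}) : Prop :=
  ∀ X : Type u, ((#X : Cardinal.{u}) : WithTop Cardinal.{u}) < κ → ¬ IsMeasurableSet ℵ₁ X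

/-- Banach vector spaces over a (non-Archimedean) normed field `k`. -/
structure BanachSpace (k : Type u) [NormedField k] where
  carrier : Type u
  [group : NormedAddCommGroup carrier]
  [space : NormedSpace k carrier]
  [ultrametric : IsUltrametricDist carrier]
  [complete : CompleteSpace carrier]

namespace BanachSpace

instance (k : Type u) [NormedField k] : CoeSort (BanachSpace k) (Type u) := ⟨carrier⟩

attribute [instance] group space ultrametric complete

/-- Isomorphism of Banach spaces: a `k`-linear isometric bijection. -/
def Iso {k : Type u} [NormedField k] (V W : BanachSpace k) : Prop :=
  Nonempty (V ≃ₗᵢ[k] W)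

section

variable {k : Type u} [NormedField k] {I : Type u}

theorem isUltrametricDist_lp (W : I → BanachSpace k) :
    IsUltrametricDist (lp (fun i => (W i : Type u)) ∞) := by
  refine IsUltrametricDist.isUltrametricDist_of_forall_norm_add_le_max_norm fun x y => ?_
  refine lp.norm_le_of_forall_le (le_max_of_le_left (norm_nonneg x)) fun i => ?_
  calc ‖(x + y) i‖ = ‖x i + y i‖ := rfl
    _ ≤ max ‖x i‖ ‖y i‖ := IsUltrametricDist.norm_add_le_max _ _
    _ ≤ max ‖x‖ ‖y‖ := max_le_max (lp.norm_apply_le_norm ENNReal.top_ne_zero x i)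
        (lp.norm_apply_le_norm ENNReal.top_ne_zero y i)

/-- The bounded direct product `Π_I W`: bounded families with the supremum norm. -/
noncomputable def boundedProd (W : I → BanachSpace k) : BanachSpace k :=
  letI := isUltrametricDist_lp W
  { carrier := lp (fun i => (W i : Type u)) ∞ }

/-- The families `w` in `Π_I W` such that `{i | ε ≤ ‖w i‖}` is finite for every `ε > 0`. -/
def nullFamilies (W : I → BanachSpace k) :
    Submodule k (lp (fun i => (W i : Type u)) ∞) where
  carrier := {w | ∀ ε : ℝ, 0 < ε → {i : I | ε ≤ ‖w i‖}.Finite}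
  zero_mem' := by
    intro ε hε
    refine Set.finite_empty.subset fun i hi => ?_
    have h : ε ≤ ‖(0 : W i)‖ := hi
    rw [norm_zero] at h
    exact absurd h (not_le.2 hε)
  add_mem' := by
    intro a b ha hb ε hε
    refine ((ha ε hε).union (hb ε hε)).subset fun i hi => ?_
    have h : ε ≤ ‖a i + b i‖ := hi
    exact le_max_iff.1 (h.trans (IsUltrametricDist.norm_add_le_max _ _))
  smul_mem' := by
    intro c a ha ε hε
    have hc : 0 < ‖c‖ + 1 := by positivity
    refine (ha (ε / (‖c‖ + 1)) (by positivity)).subset fun i hi => ?_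
    have h : ε ≤ ‖c • a i‖ := hi
    rw [norm_smul] at h
    have h2 : ‖c‖ * ‖a i‖ ≤ ‖a i‖ * (‖c‖ + 1) := by nlinarith [norm_nonneg (a i)]
    exact (div_le_iff₀ hc).2 (h.trans h2)

theorem isClosed_nullFamilies (W : I → BanachSpace k) :
    IsClosed (nullFamilies W : Set (lp (fun i => (W i : Type u)) ∞)) := by
  refine isClosed_of_closure_subset fun w hw ε hε => ?_
  obtain ⟨v, hv, hd⟩ := Metric.mem_closure_iff.1 hw (ε / 2) (by positivity)
  refine (hv (ε / 2) (by positivity)).subset fun i hi => ?_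
  have h : ε ≤ ‖w i‖ := hi
  have h1 : ‖w i - v i‖ ≤ ‖w - v‖ := lp.norm_apply_le_norm ENNReal.top_ne_zero (w - v) i
  have h2 : ‖w i‖ ≤ ‖w i - v i‖ + ‖v i‖ := by
    simpa using norm_add_le (w i - v i) (v i)
  rw [dist_eq_norm] at hd
  have h3 : ε / 2 ≤ ‖v i‖ := by linarith
  exact h3

theorem isUltrametricDist_nullFamilies (W : I → BanachSpace k) :
    IsUltrametricDist (nullFamilies W) :=
  ⟨fun x y z => (isUltrametricDist_lp W).dist_triangle_max x.1 y.1 z.1⟩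

/-- The completed direct sum `Σ_I W`, a closed subspace of `Π_I W` with the induced norm. -/
noncomputable def completedSum (W : I → BanachSpace k) : BanachSpace k :=
  letI := isUltrametricDist_nullFamilies W
  letI : CompleteSpace (nullFamilies W) := (isClosed_nullFamilies W).completeSpace_coe
  { carrier := nullFamilies W }

end

/-- `ℓ^∞(I, V)`. -/
noncomputable def ellInfty {k : Type u} [NormedField k] (I : Type u) (V : BanachSpace k) :
    BanachSpace k :=
  boundedProd fun _ : I => V

/-- `C₀(I, V)`. -/
noncomputable def cZero {k : Type u} [NormedField k] (I : Type u) (V : BanachSpace k) :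
    BanachSpace k :=
  completedSum fun _ : I => V

/-- The spaces `V_{t,n}`: `V_{t,0} = k`, `V_{0,n+1} = ℓ^∞(I, V_{1,n})` and
`V_{1,n+1} = C₀(I, V_{0,n})`. -/
noncomputable def alternating (k : Type u) [NormedField k] [IsUltrametricDist k]
    [CompleteSpace k] (I : Type u) : Fin 2 → ℕ → BanachSpace k
  | _, 0 => { carrier := k }
  | 0, n + 1 => ellInfty I (alternating k I 1 n)
  | 1, n + 1 => cZero I (alternating k I 0 n)

end BanachSpace

/-! Isometric isomorphism is weakened to being a retract: a summand with contractive injection and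
projection. The engine is a version of Chase's lemma, `exists_strictly_contractive_cofinite`: a
contraction from `ℓ^∞` to `C₀` has norm bounded by some `δ < 1` once finitely many coordinates are
dropped in the source and in the target. A gliding hump proves this along decreasing sequences of
index sets with empty intersection; the absence of non-principal countably complete ultrafilters
upgrades it to cofinite sets. Suppose a space of one type is a retract of a space of the other type
over `W`. The retraction factors through a map between the two types to which Chase's lemma applies,
so up to an error `δ < 1` the identity factors through a finite power of `W`. Since contractions
composing to nearly the identity can be corrected (`isRetract_of_norm_sub_le`), the first space is a
retract of that finite power (`exists_isRetract_finite_power`). This lowers the level by one, and an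
induction ending in a dimension count shows that `V_{t,n+1}` is never a retract of a finite power of
`V_{t,n}`. Hence for `n ≥ 1` neither of `V_{0,n}`, `V_{1,n}` is a retract of the other, whereas both
are retracts of every space of higher level; together these facts separate all the spaces. -/

namespace BanachSpace

/-! ### Bounded and null families in a uniform notation -/

section Family

variable {k : Type u} [NormedField k] {I J A B : Type u} {V W X : BanachSpace k}

/-- The spaces `ℓ^∞(I, V)` (for `t = 0`) and `C₀(I, V)` (for `t = 1`). -/
noncomputable def family (t : Fin 2) (I : Type u) (V : BanachSpace k) : BanachSpace k :=
  match t with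
  | 0 => ellInfty I V
  | 1 => cZero I V

/-- The families that belong to `family t I V`. -/
def Admissible (t : Fin 2) (v : I → V) : Prop :=
  match t with
  | 0 => ∃ C : ℝ, ∀ i, ‖v i‖ ≤ C
  | 1 => ∀ ε : ℝ, 0 < ε → {i : I | ε ≤ ‖v i‖}.Finite

/-- The underlying family of an element of `family t I V`. -/
noncomputable def coord (t : Fin 2) : family t I V →ₗ[k] (I → V) :=
  match t with
  | 0 =>
    { toFun := fun x => ((show lp (fun _ : I => (V : Type u)) ∞ from x) : I → V)
      map_add' := fun _ _ => rfl
      map_smul' := fun _ _ => rfl }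
  | 1 =>
    { toFun := fun x => ((show nullFamilies (fun _ : I => V) from x).1 : I → V)
      map_add' := fun _ _ => rfl
      map_smul' := fun _ _ => rfl }

theorem norm_coord_le (t : Fin 2) (x : family t I V) (i : I) : ‖coord t x i‖ ≤ ‖x‖ := by
  match t with
  | 0 =>
    exact lp.norm_apply_le_norm ENNReal.top_ne_zero
      (show lp (fun _ : I => (V : Type u)) ∞ from x) i
  | 1 =>
    exact lp.norm_apply_le_norm ENNReal.top_ne_zero
      (show nullFamilies (fun _ : I => V) from x).1 i

theorem norm_le_of_coord_le {t : Fin 2} {x : family t I V} {C : ℝ} (hC : 0 ≤ C)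
    (h : ∀ i, ‖coord t x i‖ ≤ C) : ‖x‖ ≤ C := by
  match t with
  | 0 =>
    exact lp.norm_le_of_forall_le (f := (show lp (fun _ : I => (V : Type u)) ∞ from x)) hC h
  | 1 =>
    exact lp.norm_le_of_forall_le
      (f := (show nullFamilies (fun _ : I => V) from x).1) hC h

theorem coord_injective (t : Fin 2) : Function.Injective (coord t : family t I V → I → V) := by
  refine (injective_iff_map_eq_zero (coord t : family t I V →ₗ[k] (I → V))).2 fun x hx => ?_
  refine norm_le_zero_iff.1 (norm_le_of_coord_le le_rfl fun i => ?_)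
  rw [hx]
  simp

theorem admissible_coord (t : Fin 2) (x : family t I V) : Admissible t (coord t x) := by
  match t with
  | 0 => exact ⟨‖x‖, norm_coord_le 0 x⟩
  | 1 => exact (show nullFamilies (fun _ : I => V) from x).2

theorem admissible_of_finite_support {t : Fin 2} {v : I → V} (h : (Function.support v).Finite) :
    Admissible t v := by
  match t with
  | 0 =>
    obtain ⟨C, hC⟩ := (h.image fun i => ‖v i‖).bddAbove
    refine ⟨max C 0, fun i => ?_⟩
    by_cases hi : v i = 0
    · simp [hi]
    · exact le_max_of_le_left (hC ⟨i, hi, rfl⟩)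
  | 1 =>
    intro ε hε
    refine h.subset fun i hi => ?_
    exact norm_pos_iff.1 (hε.trans_le hi)

theorem Admissible.bounded {t : Fin 2} {v : I → V} (h : Admissible t v) :
    ∃ C : ℝ, ∀ i, ‖v i‖ ≤ C := by
  match t with
  | 0 => exact h
  | 1 =>
    obtain ⟨C, hC⟩ := ((h 1 one_pos).image fun i => ‖v i‖).bddAbove
    refine ⟨max C 1, fun i => ?_⟩
    rcases le_total 1 ‖v i‖ with hi | hi
    · exact le_max_of_le_left (hC ⟨i, hi, rfl⟩)
    · exact le_max_of_le_right hi

theorem exists_coord_eq {t : Fin 2} {v : I → V} (h : Admissible t v) :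
    ∃ x : family t I V, coord t x = v := by
  obtain ⟨C, hC⟩ := h.bounded
  have hm : Memℓp v ∞ := memℓp_infty ⟨C, by rintro _ ⟨i, rfl⟩; exact hC i⟩
  match t with
  | 0 => exact ⟨(⟨v, hm⟩ : lp (fun _ : I => (V : Type u)) ∞), rfl⟩
  | 1 => exact ⟨(⟨⟨v, hm⟩, h⟩ : nullFamilies (fun _ : I => V)), rfl⟩

/-- Families are admissible if they are dominated, along an injection of their support, by
an admissible family. -/
theorem Admissible.of_le {t : Fin 2} {v : I → V} (h : Admissible t v) {w : J → W} (g : J → I)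
    (hg : InjOn g (Function.support w)) (hw : ∀ j, w j ≠ 0 → ‖w j‖ ≤ ‖v (g j)‖) :
    Admissible t w := by
  match t with
  | 0 =>
    obtain ⟨C, hC⟩ := h
    refine ⟨max C 0, fun j => ?_⟩
    by_cases hj : w j = 0
    · simp [hj]
    · exact le_max_of_le_left ((hw j hj).trans (hC _))
  | 1 =>
    intro ε hε
    have hs : {j | ε ≤ ‖w j‖} ⊆ Function.support w := fun j hj =>
      norm_pos_iff.1 (hε.trans_le hj)
    refine Set.Finite.of_injOn (f := g) (fun j hj => ?_) (hg.mono hs) (h ε hε)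
    exact le_trans (show ε ≤ ‖w j‖ from hj) (hw j (hs hj))

/-- The linear map into `family t I V` with given coordinates. -/
theorem exists_lift {t : Fin 2} (φ : X →ₗ[k] (I → V)) (hφ : ∀ x, Admissible t (φ x))
    (hn : ∀ x i, ‖φ x i‖ ≤ ‖x‖) :
    ∃ Φ : X →ₗ[k] family t I V, (∀ x, ‖Φ x‖ ≤ ‖x‖) ∧ ∀ x, coord t (Φ x) = φ x := by
  choose Φ hΦ using fun x => exists_coord_eq (hφ x)
  refine ⟨{ toFun := Φ, map_add' := fun x y => ?_, map_smul' := fun c x => ?_ }, fun x => ?_, hΦ⟩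
  · apply coord_injective
    simp [hΦ]
  · apply coord_injective
    simp [hΦ]
  · refine norm_le_of_coord_le (norm_nonneg x) fun i => ?_
    simpa [hΦ] using hn x i

/-- Extension by zero along an embedding. -/
theorem exists_extend {t t' : Fin 2} (e : A ↪ B) (h : t = t' ∨ Finite A) :
    ∃ E : family t A V →ₗ[k] family t' B V, (∀ x, ‖E x‖ ≤ ‖x‖) ∧
      (∀ x a, coord t' (E x) (e a) = coord t x a) ∧
      ∀ x, ∀ b ∉ range e, coord t' (E x) b = 0 := by
  have he := e.injective
  have hs (v : A → V) : Function.support (Function.extend e v 0) ⊆ range e := fun b hb => by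
    by_contra hbr
    exact hb (Function.extend_apply' _ _ _ hbr)
  let φ : family t A V →ₗ[k] (B → V) :=
    { toFun := fun x => Function.extend e (coord t x) 0
      map_add' := fun x y => by
        ext b
        by_cases hb : ∃ a, e a = b
        · obtain ⟨a, rfl⟩ := hb
          simp [he.extend_apply]
        · simp [Function.extend_apply' _ _ _ hb]
      map_smul' := fun c x => by
        ext b
        by_cases hb : ∃ a, e a = b
        · obtain ⟨a, rfl⟩ := hb
          simp [he.extend_apply]
        · simp [Function.extend_apply' _ _ _ hb] }
  have hadm (x) : Admissible t' (φ x) := by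
    -- Over a finite index set every family is admissible for both types, so the type may change.
    rcases h with rfl | h
    · rcases isEmpty_or_nonempty A with hA | hA
      · exact admissible_of_finite_support ((Set.finite_range e).subset (hs _))
      · refine (admissible_coord t x).of_le (Function.invFun e) ?_ ?_
        · intro b hb b' hb' hbb
          obtain ⟨a, rfl⟩ := hs _ hb
          obtain ⟨a', rfl⟩ := hs _ hb'
          rw [Function.leftInverse_invFun he, Function.leftInverse_invFun he] at hbb
          rw [hbb]
        · intro b hb
          obtain ⟨a, rfl⟩ := hs _ hb
          rw [Function.leftInverse_invFun he]
          exact (congrArg norm (he.extend_apply (coord t x) 0 a)).le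
    · exact admissible_of_finite_support ((Set.finite_range e).subset (hs _))
  have hnorm (x b) : ‖φ x b‖ ≤ ‖x‖ := by
    by_cases hb : ∃ a, e a = b
    · obtain ⟨a, rfl⟩ := hb
      exact (congrArg norm (he.extend_apply (coord t x) 0 a)).le.trans (norm_coord_le t x a)
    · have : φ x b = 0 := Function.extend_apply' _ _ _ hb
      simp [this]
  obtain ⟨E, hE, hc⟩ := exists_lift φ hadm hnorm
  refine ⟨E, hE, fun x a => ?_, fun x b hb => ?_⟩
  · rw [hc]
    exact he.extend_apply _ _ _
  · rw [hc]
    exact Function.extend_apply' _ _ _ hb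

/-- Restriction along an embedding. -/
theorem exists_restrict {t t' : Fin 2} (e : A ↪ B) (h : t = t' ∨ Finite A) :
    ∃ R : family t B V →ₗ[k] family t' A V, (∀ x, ‖R x‖ ≤ ‖x‖) ∧
      ∀ x a, coord t' (R x) a = coord t x (e a) := by
  have hadm (x : family t B V) : Admissible t' (fun a => coord t x (e a)) := by
    rcases h with rfl | h
    · exact (admissible_coord t x).of_le e e.injective.injOn fun j _ => le_rfl
    · exact admissible_of_finite_support (Set.toFinite _)
  obtain ⟨R, hR, hc⟩ := exists_lift ((LinearMap.funLeft k V e).comp (coord t)) hadm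
    fun x a => norm_coord_le t x (e a)
  exact ⟨R, hR, fun x a => by rw [hc]; rfl⟩

/-! ### Contractive retracts -/

/-- `V` is a direct summand of `W` with contractive injection and projection. -/
def IsRetract (V W : BanachSpace k) : Prop :=
  ∃ (s : V →ₗ[k] W) (r : W →ₗ[k] V), (∀ x, ‖s x‖ ≤ ‖x‖) ∧ (∀ y, ‖r y‖ ≤ ‖y‖) ∧ ∀ x, r (s x) = x

theorem IsRetract.trans (h₁ : IsRetract V W) (h₂ : IsRetract W X) : IsRetract V X := by
  obtain ⟨s, r, hs, hr, h⟩ := h₁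
  obtain ⟨s', r', hs', hr', h'⟩ := h₂
  exact ⟨s' ∘ₗ s, r ∘ₗ r', fun x => (hs' _).trans (hs x), fun y => (hr _).trans (hr' y),
    fun x => by simp [h, h']⟩

theorem Iso.isRetract (h : V.Iso W) : IsRetract V W := by
  obtain ⟨e⟩ := h
  exact ⟨e.toLinearEquiv.toLinearMap, e.symm.toLinearEquiv.toLinearMap,
    fun x => (e.norm_map x).le, fun y => (e.symm.norm_map y).le, fun x => e.symm_apply_apply x⟩

theorem Iso.symm (h : V.Iso W) : W.Iso V := h.map LinearIsometryEquiv.symm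

theorem isRetract_family_of_embedding {t t' : Fin 2} (e : A ↪ B) (h : t = t' ∨ Finite A) :
    IsRetract (family t A V) (family t' B V) := by
  obtain ⟨E, hE, hc, -⟩ := exists_extend (V := V) e h
  obtain ⟨R, hR, hc'⟩ := exists_restrict (V := V) e (h.imp_left Eq.symm)
  refine ⟨E, R, hE, hR, fun x => coord_injective t ?_⟩
  ext a
  rw [hc', hc]

theorem IsRetract.family {t : Fin 2} (h : IsRetract V W) :
    IsRetract (family t I V) (BanachSpace.family t I W) := by
  obtain ⟨s, r, hs, hr, h⟩ := h
  obtain ⟨S, hS, hS'⟩ := exists_lift (t := t)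
    ((LinearMap.compLeft s I).comp (coord (V := V) t))
    (fun x => (admissible_coord t x).of_le id (injOn_id _) fun i _ => hs _)
    fun x i => (hs _).trans (norm_coord_le t x i)
  obtain ⟨R, hR, hR'⟩ := exists_lift (t := t)
    ((LinearMap.compLeft r I).comp (coord (V := W) t))
    (fun x => (admissible_coord t x).of_le id (injOn_id _) fun i _ => hr _)
    fun x i => (hr _).trans (norm_coord_le t x i)
  refine ⟨S, R, hS, hR, fun x => coord_injective t ?_⟩
  ext i
  simp [hS', hR', h]

theorem isRetract_family_self {t : Fin 2} [Nonempty I] :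
    IsRetract V (family t I V) := by
  classical
  obtain ⟨i₀⟩ := ‹Nonempty I›
  obtain ⟨S, hS, hS'⟩ := exists_lift (t := t) (LinearMap.single k (fun _ : I => (V : Type u)) i₀)
    (fun x => admissible_of_finite_support ((Set.finite_singleton i₀).subset fun i hi => by
      by_contra h
      exact hi (Pi.single_eq_of_ne (M := fun _ : I => (V : Type u)) h x))) fun x i => by
      rcases eq_or_ne i i₀ with rfl | h
      · simp
      · simp [Pi.single_eq_of_ne h]
  refine ⟨S, (LinearMap.proj i₀).comp (coord t), hS, fun y => norm_coord_le t y i₀, fun x => ?_⟩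
  simp [hS']

/-- Lets a finite power of `family t I V` be absorbed into one such space, since `A × I` embeds in
an infinite `I`. Finiteness of `A` keeps the glued family null when `t = 1`. -/
theorem isRetract_family_prod {t : Fin 2} [Finite A] :
    IsRetract (family t A (family t I V)) (family t (A × I) V) := by
  have h1 (w : family t (A × I) V) (a : A) : Admissible t fun i => coord t w (a, i) :=
    (admissible_coord t w).of_le (fun i => (a, i)) (fun i _ j _ h => (Prod.mk.inj h).2)
      fun _ _ => le_rfl
  have h2 (a : A) : ∃ R : family t (A × I) V →ₗ[k] family t I V, (∀ x, ‖R x‖ ≤ ‖x‖) ∧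
      ∀ x, coord t (R x) = fun i => coord t x (a, i) :=
    exists_lift (t := t) ((LinearMap.funLeft k V (fun i => (a, i))).comp (coord t))
      (fun x => h1 x a) fun x i => norm_coord_le t x (a, i)
  choose ρ hρ hρ' using h2
  obtain ⟨R, hR, hR'⟩ := exists_lift (t := t) (LinearMap.pi ρ)
    (fun x => admissible_of_finite_support (Set.toFinite _)) fun x a => hρ a x
  have hφ (x : family t A (family t I V)) :
      Admissible t fun p : A × I => coord t (coord t x p.1) p.2 := by
    match t with
    | 0 => exact ⟨‖x‖, fun p => (norm_coord_le 0 _ _).trans (norm_coord_le 0 _ _)⟩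
    | 1 =>
      intro ε hε
      refine (Set.finite_iUnion fun a : A =>
        (admissible_coord 1 (coord 1 x a) ε hε).image (Prod.mk a)).subset fun p hp => ?_
      exact mem_iUnion.2 ⟨p.1, p.2, hp, rfl⟩
  let φ : family t A (family t I V) →ₗ[k] (A × I → V) :=
    LinearMap.pi fun p => (LinearMap.proj p.2).comp
      ((coord t).comp ((LinearMap.proj p.1).comp (coord t)))
  obtain ⟨S, hS, hS'⟩ := exists_lift φ hφ fun x p =>
    (norm_coord_le t _ _).trans (norm_coord_le t _ _)
  refine ⟨S, R, hS, hR, fun x => coord_injective t ?_⟩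
  ext a
  refine coord_injective t ?_
  ext i
  simp [hR', hS', hρ', φ]

/-- Contractions whose composition is close to the identity make `V` a retract. -/
theorem isRetract_of_norm_sub_le (s : V →ₗ[k] W) (r : W →ₗ[k] V) (hs : ∀ x, ‖s x‖ ≤ ‖x‖)
    (hr : ∀ y, ‖r y‖ ≤ ‖y‖) {δ : ℝ} (hδ : δ < 1) (h : ∀ x, ‖x - r (s x)‖ ≤ δ * ‖x‖) :
    IsRetract V W := by
  let u : V →ₗ[k] V := r ∘ₗ s
  -- In an ultrametric space `u` close to the identity cannot shrink norms, so its inverse is again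
  -- a contraction and may be composed with `r`.
  have hu : ∀ x, ‖x‖ ≤ ‖u x‖ := fun x => by
    by_contra! hx
    have h1 : ‖x‖ ≤ max ‖x - u x‖ ‖u x‖ := by
      simpa using IsUltrametricDist.norm_add_le_max (x - u x) (u x)
    have h2 : ‖x - u x‖ < ‖x‖ := (h x).trans_lt (by
      nlinarith [(norm_nonneg (u x)).trans_lt hx])
    exact absurd h1 (not_le.2 (max_lt h2 hx))
  have hinj : Function.Injective u := (injective_iff_map_eq_zero u).2 fun x hx =>
    norm_le_zero_iff.1 ((hu x).trans (by rw [hx, norm_zero]))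
  have hsurj : Function.Surjective u := fun y => by
    -- A fixed point of this map solves `u x = y`.
    have hc : ContractingWith δ.toNNReal fun x : V => y + (x - u x) := by
      refine ⟨by simpa using hδ, LipschitzWith.of_dist_le_mul fun a b => ?_⟩
      have h1 : y + (a - u a) - (y + (b - u b)) = (a - b) - u (a - b) := by
        rw [map_sub]; abel
      rw [dist_eq_norm, dist_eq_norm, h1]
      exact (h _).trans (mul_le_mul_of_nonneg_right (Real.le_coe_toNNReal δ) (norm_nonneg _))
    have := hc.fixedPoint_isFixedPt
    refine ⟨hc.fixedPoint, ?_⟩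
    have h2 : y + (hc.fixedPoint - u hc.fixedPoint) = hc.fixedPoint := this
    exact (sub_sub_cancel _ _).symm.trans (sub_eq_iff_eq_add.2 h2.symm)
  let e := LinearEquiv.ofBijective u ⟨hinj, hsurj⟩
  refine ⟨s, e.symm.toLinearMap ∘ₗ r, hs, fun y => ?_, fun x => e.symm_apply_apply x⟩
  refine (hu _).trans ?_
  have : u (e.symm (r y)) = r y := e.apply_symm_apply _
  exact (congrArg norm this).le.trans (hr y)

end Family
end BanachSpace

/-! ### Ideals of sets and countably complete ultrafilters -/

section Ideal

variable {A : Type u}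

/-- An ideal of sets that meets every decreasing sequence with empty intersection contains the
complement of a finite set, if there are no non-principal countably complete ultrafilters. -/
theorem exists_finite_compl_of_ideal
    (hA : ∀ F : Ultrafilter A, CountableInterFilter (F : Filter A) → ∃ a, F = pure a)
    {Good : Set A → Prop} (mono : ∀ S T, S ⊆ T → Good T → Good S)
    (union : ∀ S T, Good S → Good T → Good (S ∪ T))
    (tail : ∀ S : ℕ → Set A, Antitone S → ⋂ n, S n = ∅ → ∃ n, Good (S n)) :
    ∃ F : Set A, F.Finite ∧ Good Fᶜ := by
  have hempty : Good ∅ := by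
    obtain ⟨n, hn⟩ := tail (fun _ => ∅) antitone_const (iInter_const ∅)
    exact hn
  have hiUnion : ∀ G : ℕ → Set A, (∀ n, Good (G n)) → Good (⋃ n, G n) := by
    intro G hG
    have hacc : ∀ n, Good (Set.accumulate G n) := fun n => by
      induction n with
      | zero => simpa using hG 0
      | succ n ih => rw [Set.accumulate_succ]; exact union _ _ ih (hG _)
    -- What the partial unions miss decreases to the empty set, so some partial union misses only a
    -- good set.
    obtain ⟨n, hn⟩ := tail (fun n => (⋃ n, G n) \ Set.accumulate G n)
      (fun m n h => sdiff_subset_sdiff_right (Set.monotone_accumulate h)) (by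
        refine eq_empty_of_forall_notMem fun a ha => ?_
        rw [mem_iInter] at ha
        obtain ⟨n, hn⟩ := mem_iUnion.1 (ha 0).1
        exact (ha n).2 (Set.subset_accumulate hn))
    exact mono _ _ (fun a ha => (em (a ∈ Set.accumulate G n)).elim Or.inr fun h => Or.inl ⟨ha, h⟩)
      (union _ _ hn (hacc n))
  have hatom : ∀ S, ¬ Good S → ∃ T ⊆ S, ¬ Good T ∧ ∀ U ⊆ T, Good U ∨ Good (T \ U) := by
    intro S hS
    by_contra! hno
    choose! U hUT hU hTU using hno
    -- Without atoms, bad sets can be shrunk forever with every removed piece `seq n \ seq (n + 1)`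
    -- bad; but `tail` makes the larger set `seq n \ ⋂ m, seq m` good for some `n`.
    let seq : ℕ → Set A := fun n => Nat.rec S (fun _ T => U T) n
    have hseq : ∀ n, seq n ⊆ S ∧ ¬ Good (seq n) := fun n => by
      induction n with
      | zero => exact ⟨subset_rfl, hS⟩
      | succ n ih => exact ⟨(hUT _ ih.1 ih.2).trans ih.1, hU _ ih.1 ih.2⟩
    have hanti : Antitone seq := antitone_nat_of_succ_le fun n => hUT _ (hseq n).1 (hseq n).2
    obtain ⟨n, hn⟩ := tail (fun n => seq n \ ⋂ m, seq m)
      (fun m n h => sdiff_subset_sdiff_left (hanti h)) (by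
        refine eq_empty_of_forall_notMem fun a ha => ?_
        rw [mem_iInter] at ha
        exact (ha 0).2 (mem_iInter.2 fun n => (ha n).1))
    refine hTU _ (hseq n).1 (hseq n).2 (mono _ _ (sdiff_subset_sdiff_right ?_) hn)
    exact iInter_subset seq (n + 1)
  have hpoint : ∀ S, ¬ Good S → ∃ a ∈ S, ¬ Good {a} := by
    intro S hS
    obtain ⟨T, hTS, hT, hsplit⟩ := hatom S hS
    -- The sets that are co-good in the atom `T` form an ultrafilter, countably complete by
    -- `hiUnion`; it is therefore principal, at a bad point.
    let f : Filter A :=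
      { sets := {U | Good (T \ U)}
        univ_sets := by simpa using hempty
        sets_of_superset := fun {U U'} hU h => mono _ _ (sdiff_subset_sdiff_right h) hU
        inter_sets := fun {U U'} hU hU' => by
          simp only [mem_ofPred_eq, sdiff_inter] at *
          exact union _ _ hU hU' }
    have hf : ∀ U, U ∈ f ↔ Good (T \ U) := fun _ => Iff.rfl
    have hcompl : ∀ U, Uᶜ ∉ f ↔ U ∈ f := fun U => by
      rw [hf, hf]
      refine ⟨fun h => ?_, fun h h' => hT ?_⟩
      · refine (hsplit (T ∩ U) inter_subset_left).elim (fun h' => (h ?_).elim) fun h' => ?_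
        · rwa [sdiff_compl]
        · rwa [sdiff_self_inter] at h'
      · rw [sdiff_compl] at h'
        have := union _ _ h h'
        rwa [sdiff_union_inter] at this
    let F : Ultrafilter A := Ultrafilter.ofComplNotMemIff f hcompl
    have hF : CountableInterFilter (F : Filter A) := by
      refine ⟨fun 𝒮 h𝒮 h => ?_⟩
      rcases 𝒮.eq_empty_or_nonempty with rfl | hne
      · simp
      · obtain ⟨g, rfl⟩ := h𝒮.exists_eq_range hne
        change Good (T \ ⋂₀ range g)
        rw [sInter_range, sdiff_iInter]
        exact hiUnion _ fun n => h _ (mem_range_self n)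
    obtain ⟨a, ha⟩ := hA F hF
    have hmem : ∀ U, a ∈ U ↔ Good (T \ U) := fun U => by
      rw [← hf]
      change _ ↔ U ∈ F
      rw [ha, Ultrafilter.mem_pure]
    have haT : a ∈ T := (hmem T).2 (by simpa using hempty)
    refine ⟨a, hTS haT, fun h => ?_⟩
    have := (hmem ({a}ᶜ)).2 (mono _ _ (by simp) h)
    exact this rfl
  refine ⟨{a | ¬ Good {a}}, ?_, ?_⟩
  · by_contra hinf
    have hinf' : {a | ¬ Good {a}}.Infinite := hinf
    let e := hinf'.natEmbedding
    obtain ⟨n, hn⟩ := tail (fun n => {a | ∃ m ≥ n, (e m : A) = a})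
      (fun m n h a ⟨j, hj, hja⟩ => ⟨j, le_trans h hj, hja⟩) (by
        refine eq_empty_of_forall_notMem fun a ha => ?_
        rw [mem_iInter] at ha
        obtain ⟨m, -, hm⟩ := ha 0
        obtain ⟨j, hj, hja⟩ := ha (m + 1)
        have : j = m := e.injective (Subtype.ext (hja.trans hm.symm))
        omega)
    exact (e n).2 (mono _ _ (by rintro _ rfl; exact ⟨n, le_rfl, rfl⟩) hn)
  · by_contra h
    obtain ⟨a, ha, ha'⟩ := hpoint _ h
    exact ha ha'

end Ideal

namespace BanachSpace
-- Chase's lemma by a gliding hump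
section Chase

variable {k : Type u} [NormedField k] {A B : Type u} {V W : BanachSpace k}

theorem exists_norm_mem_Ioo (hk : DenseRange (fun x : k => ‖x‖₊)) {a b : ℝ} (ha : 0 ≤ a)
    (hab : a < b) : ∃ c : k, a < ‖c‖ ∧ ‖c‖ < b := by
  obtain ⟨c, hc⟩ := hk.exists_mem_open (isOpen_Ioo (a := (⟨a, ha⟩ : ℝ≥0)) (b := ⟨b, ha.trans hab.le⟩))
    ⟨⟨(a + b) / 2, by linarith⟩, show a < (a + b) / 2 by linarith,
      show (a + b) / 2 < b by linarith⟩
  exact ⟨c, hc.1, hc.2⟩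

/-- A gliding hump argument: a contraction from a bounded product to families that vanish at
infinity is strictly contractive, up to finitely many coordinates, on the tail of the product. -/
theorem exists_strictly_contractive_tail (hk : DenseRange (fun x : k => ‖x‖₊))
    (f : family 0 A V →ₗ[k] (B → W)) (hf : ∀ x b, ‖f x b‖ ≤ ‖x‖)
    (hfin : ∀ x, {b | 1 ≤ ‖f x b‖}.Finite) (S : ℕ → Set A) (hS : Antitone S)
    (hS0 : ⋂ n, S n = ∅) :
    ∃ n, ∃ J : Finset B, ∃ δ < (1 : ℝ), ∀ x : family 0 A V, (∀ a ∉ S n, coord 0 x a = 0) →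
      ∀ b ∉ J, ‖f x b‖ ≤ δ * ‖x‖ := by
  classical
  by_contra! hbad
  -- The norms strictly decrease but stay above `1`: each hump `x n` has norm at most `ρ n` and an
  -- image coordinate above `ρ (n + 1)`, the bound for all later humps.
  let ρ : ℕ → ℝ := fun n => 1 + 1 / ((n : ℝ) + 1)
  have hρ1 : ∀ n, 1 < ρ n := fun n => by
    have : (0 : ℝ) < 1 / ((n : ℝ) + 1) := by positivity
    simp only [ρ]; linarith
  have hρs : ∀ n, ρ (n + 1) < ρ n := fun n => by
    have := Nat.one_div_lt_one_div (α := ℝ) (Nat.lt_succ_self n)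
    simp only [ρ]; linarith
  have hρanti : Antitone ρ := antitone_nat_of_succ_le fun n => (hρs n).le
  have hstep : ∀ (n : ℕ) (J : Finset B), ∃ (x : family 0 A V) (b : B),
      (∀ a ∉ S n, coord 0 x a = 0) ∧ b ∉ J ∧ ‖x‖ ≤ ρ n ∧ ρ (n + 1) < ‖f x b‖ := by
    intro n J
    have h0 : 0 < ρ n := one_pos.trans (hρ1 n)
    have h1 : 0 < ρ (n + 1) := one_pos.trans (hρ1 _)
    obtain ⟨x, hx, b, hb, hlt⟩ := hbad n J (ρ (n + 1) / ρ n) ((div_lt_one h0).2 (hρs n))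
    have hfx : 0 < ‖f x b‖ := lt_of_le_of_lt (by positivity) hlt
    have hx0 : 0 < ‖x‖ := hfx.trans_le (hf x b)
    -- Density of the value set permits rescaling `x` into this narrow window.
    obtain ⟨c, hc1, hc2⟩ := exists_norm_mem_Ioo hk (a := ρ (n + 1) / ‖f x b‖) (b := ρ n / ‖x‖)
      (by positivity) (by
        rw [div_mul_eq_mul_div, div_lt_iff₀ h0] at hlt
        rw [div_lt_div_iff₀ hfx hx0]
        linarith)
    refine ⟨c • x, b, fun a ha => by simp [hx a ha], hb, ?_, ?_⟩
    · rw [norm_smul]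
      exact ((lt_div_iff₀ hx0).1 hc2).le
    · rw [map_smul, Pi.smul_apply, norm_smul]
      exact (div_lt_iff₀ hfx).1 hc1
  choose X β hXS hβ hX hfX using hstep
  -- `J n` collects the coordinates at which an earlier hump has image of norm at least `1`; the
  -- next hump is detected outside it.
  let J : ℕ → Finset B := fun n => Nat.rec ∅ (fun n J => J ∪ (hfin (X n J)).toFinset) n
  let x : ℕ → family 0 A V := fun n => X n (J n)
  let b : ℕ → B := fun n => β n (J n)
  have hJ : ∀ n, J (n + 1) = J n ∪ (hfin (x n)).toFinset := fun n => rfl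
  have hJmono : Monotone J := monotone_nat_of_le_succ fun n => by
    rw [hJ]; exact Finset.subset_union_left
  have hsmall : ∀ m n, m < n → ‖f (x m) (b n)‖ < 1 := fun m n hmn => by
    by_contra! h
    refine hβ n (J n) (hJmono (Nat.succ_le_of_lt hmn) ?_)
    rw [Nat.succ_eq_add_one, hJ]
    exact Finset.mem_union_right _ ((hfin _).mem_toFinset.2 h)
  have hlarge : ∀ n, ρ (n + 1) < ‖f (x n) (b n)‖ := fun n => hfX n (J n)
  have hbinj : Function.Injective b := by
    refine Function.Injective.of_lt_imp_ne fun m n hmn h => ?_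
    have h1 := hsmall m n hmn
    rw [← h] at h1
    exact absurd (h1.trans (hρ1 (m + 1))) (not_lt.2 (hlarge m).le)
  have hN : ∀ a, ∃ N, a ∉ S N := fun a => by
    by_contra! h
    have : a ∈ ⋂ n, S n := mem_iInter.2 h
    rw [hS0] at this
    exact this
  choose N hN using hN
  have hvan : ∀ a n, N a ≤ n → coord 0 (x n) a = 0 := fun a n h =>
    hXS n (J n) a fun h' => hN a (hS h h')
  have hbound : ∀ m a, ‖∑ n ∈ Finset.Ico m (N a), coord 0 (x n) a‖ ≤ ρ m := fun m a => by
    refine IsUltrametricDist.norm_sum_le_of_forall_le_of_nonneg (one_pos.trans (hρ1 m)).le ?_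
    intro n hn
    exact (norm_coord_le 0 _ a).trans ((hX n (J n)).trans (hρanti (Finset.mem_Ico.1 hn).1))
  -- `y m` is the coordinatewise sum of all `x n` with `n ≥ m`, finite at each `a` because the humps
  -- vanish there from `N a` on.
  choose y hy using fun m => exists_coord_eq (t := 0)
    (v := fun a => ∑ n ∈ Finset.Ico m (N a), coord 0 (x n) a) ⟨ρ m, hbound m⟩
  have hynorm : ∀ m, ‖y m‖ ≤ ρ m := fun m =>
    norm_le_of_coord_le (one_pos.trans (hρ1 m)).le fun a => by rw [hy]; exact hbound m a
  have hysucc : ∀ m, y m = x m + y (m + 1) := fun m => by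
    refine coord_injective 0 ?_
    ext a
    rw [map_add, Pi.add_apply, hy, hy]
    dsimp only
    rcases lt_or_ge m (N a) with h | h
    · rw [Finset.sum_eq_sum_Ico_succ_bot h]
    · rw [Finset.Ico_eq_empty (by omega), Finset.Ico_eq_empty (by omega), hvan a m h]
      simp
  have hysum : ∀ m, y 0 = ∑ n ∈ Finset.range m, x n + y m := fun m => by
    induction m with
    | zero => simp
    | succ m ih => rw [ih, hysucc m, Finset.sum_range_succ, add_assoc]
  -- At `b n` the hump `x n` strictly dominates both the earlier humps and the tail `y (n + 1)`, so
  -- the image of `y 0` has norm at least `1` at infinitely many coordinates.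
  refine Set.infinite_range_of_injective hbinj ((hfin (y 0)).subset ?_)
  rintro _ ⟨n, rfl⟩
  by_contra! hlt
  rw [mem_ofPred_eq, not_le] at hlt
  have h1 : f (x n) (b n) =
      f (y 0) (b n) + (-(∑ m ∈ Finset.range n, f (x m) (b n)) + -(f (y (n + 1)) (b n))) := by
    have : f (y 0) (b n) = ∑ m ∈ Finset.range n, f (x m) (b n) + f (x n) (b n)
        + f (y (n + 1)) (b n) := by
      rw [hysum (n + 1), Finset.sum_range_succ]
      simp
    rw [this]
    abel
  have h2 : ‖f (x n) (b n)‖ ≤ ρ (n + 1) := by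
    rw [h1]
    refine (IsUltrametricDist.norm_add_le_max _ _).trans (max_le (hlt.trans (hρ1 _)).le ?_)
    refine (IsUltrametricDist.norm_add_le_max _ _).trans (max_le ?_ ?_)
    · rw [norm_neg]
      refine (IsUltrametricDist.norm_sum_le_of_forall_le_of_nonneg zero_le_one ?_).trans
        (hρ1 _).le
      intro m hm
      exact (hsmall m n (Finset.mem_range.1 hm)).le
    · rw [norm_neg]
      exact (hf _ _).trans (hynorm _)
  exact absurd h2 (not_le.2 (hlarge n))

/-- Chase's lemma for contractions from `ℓ^∞(A, V)` to families that vanish at infinity. -/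
theorem exists_strictly_contractive_cofinite (hk : DenseRange (fun x : k => ‖x‖₊))
    (hA : ∀ F : Ultrafilter A, CountableInterFilter (F : Filter A) → ∃ a, F = pure a)
    (f : family 0 A V →ₗ[k] (B → W)) (hf : ∀ x b, ‖f x b‖ ≤ ‖x‖)
    (hfin : ∀ x, {b | 1 ≤ ‖f x b‖}.Finite) :
    ∃ F : Finset A, ∃ J : Finset B, ∃ δ : ℝ, 0 ≤ δ ∧ δ < 1 ∧
      ∀ x : family 0 A V, (∀ a ∈ F, coord 0 x a = 0) → ∀ b ∉ J, ‖f x b‖ ≤ δ * ‖x‖ := by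
  classical
  obtain ⟨F, hF, J, δ, hδ, h⟩ := exists_finite_compl_of_ideal hA
    (Good := fun S => ∃ J : Finset B, ∃ δ < (1 : ℝ), ∀ x : family 0 A V,
      (∀ a ∉ S, coord 0 x a = 0) → ∀ b ∉ J, ‖f x b‖ ≤ δ * ‖x‖)
    (fun S T hST ⟨J, δ, hδ, h⟩ => ⟨J, δ, hδ, fun x hx => h x fun a ha => hx a fun h' => ha (hST h')⟩)
    (fun S T ⟨J, δ, hδ, h⟩ ⟨J', δ', hδ', h'⟩ => by
      refine ⟨J ∪ J', max (max δ δ') 0, max_lt (max_lt hδ hδ') one_pos, fun x hx b hb => ?_⟩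
      rw [Finset.mem_union, not_or] at hb
      -- Cut `x` into its parts on `S` and off `S`; the ultrametric inequality gives the maximum of
      -- the two constants.
      have hadm (U : Set A) : Admissible 0 (U.indicator (coord 0 x)) :=
        ⟨‖x‖, fun a => (norm_indicator_le_norm_self _ a).trans (norm_coord_le 0 x a)⟩
      obtain ⟨y, hy⟩ := exists_coord_eq (hadm S)
      have hz : x = y + (x - y) := by abel
      have hyn : ‖y‖ ≤ ‖x‖ := norm_le_of_coord_le (norm_nonneg x) fun a => by
        rw [hy]
        exact (norm_indicator_le_norm_self _ a).trans (norm_coord_le 0 x a)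
      have hxy : ∀ a, coord 0 (x - y) a = Sᶜ.indicator (coord 0 x) a := fun a => by
        rw [map_sub, hy, indicator_compl]
      have hzn : ‖x - y‖ ≤ ‖x‖ := norm_le_of_coord_le (norm_nonneg x) fun a => by
        rw [hxy]
        exact (norm_indicator_le_norm_self _ a).trans (norm_coord_le 0 x a)
      have h1 := h y (fun a ha => by rw [hy, indicator_of_notMem ha]) b hb.1
      have h2 := h' (x - y) (fun a ha => by
        rw [hxy]
        by_cases haS : a ∈ S
        · simp [haS]
        · rw [indicator_of_mem haS]
          exact hx a (by simp [haS, ha])) b hb.2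
      have key : ∀ z : family 0 A V, ∀ c ≤ max (max δ δ') 0, ‖z‖ ≤ ‖x‖ → ‖f z b‖ ≤ c * ‖z‖ →
          ‖f z b‖ ≤ max (max δ δ') 0 * ‖x‖ := fun z c hc hzx hz =>
        hz.trans ((mul_le_mul_of_nonneg_right hc (norm_nonneg z)).trans
          (mul_le_mul_of_nonneg_left hzx (le_max_right _ _)))
      rw [hz, map_add, ← hz]
      exact (IsUltrametricDist.norm_add_le_max _ _).trans
        (max_le (key y δ (by simp) hyn h1) (key (x - y) δ' (by simp) hzn h2)))
    (exists_strictly_contractive_tail hk f hf hfin)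
  refine ⟨hF.toFinset, J, max δ 0, le_max_right _ _, max_lt hδ one_pos, fun x hx b hb => ?_⟩
  refine (h x (fun a ha => hx a ?_) b hb).trans
    (mul_le_mul_of_nonneg_right (le_max_left _ _) (norm_nonneg x))
  simpa using ha

end Chase
end BanachSpace

/-! ### From non-measurability to principal ultrafilters -/

/-- A non-principal ultrafilter contains the complement of each point; on a countable set these
intersect to the empty set, so a countably complete one would make `I` measurable. -/
theorem ultrafilter_eq_pure_of_not_isMeasurableSet {I : Type u} (h : ¬ IsMeasurableSet ℵ₁ I)
    (F : Ultrafilter I) (hF : CountableInterFilter (F : Filter I)) : ∃ a, F = pure a := by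
  by_contra! hno
  have hsingle : ∀ a, ({a}ᶜ : Set I) ∈ F := fun a => by
    refine F.compl_mem_iff_notMem.2 fun ha => ?_
    obtain ⟨b, hb, hF'⟩ := F.eq_pure_of_finite_mem (Set.finite_singleton a) ha
    exact hno b hF'
  by_cases hI : Countable I
  · have h1 : (⋂ a : I, ({a}ᶜ : Set I)) ∈ (F : Filter I) := countable_iInter_mem.2 hsingle
    rw [← compl_iUnion, iUnion_of_singleton, compl_univ] at h1
    exact F.empty_notMem h1
  · exact h ⟨not_countable_iff.1 hI, F, cardinalInterFilter_aleph_one_iff.2 hF, hno⟩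

namespace BanachSpace

/-! ### Lowering the level and separating the spaces -/

section Alternating

variable {k : Type u} [NormedField k] {I : Type u} {V W : BanachSpace k}

theorem exists_embedding_avoiding [Infinite I] (F : Finset I) : ∃ e : I ↪ I, ∀ i, e i ∉ F := by
  have h : #((F : Set I)ᶜ : Set I) = #I := mk_compl_of_infinite _ (by
    rw [Finset.coe_sort_coe, mk_coe_finset]
    exact (natCast_lt_aleph0).trans_le (aleph0_le_mk I))
  obtain ⟨e⟩ := Cardinal.eq.1 h.symm
  exact ⟨e.toEmbedding.trans (Function.Embedding.subtype _), fun i => (e i).2⟩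

theorem exists_embedding_prod [Infinite I] (T : Type u) [Finite T] : Nonempty (T × I ↪ I) := by
  refine (Cardinal.le_def (T × I) I).1 ?_
  rw [mk_prod, lift_id, lift_id]
  exact (mul_le_max_of_aleph0_le_right (aleph0_le_mk I)).trans
    (max_le ((lt_aleph0_of_finite T).le.trans (aleph0_le_mk I)) le_rfl)

theorem norm_sub_extend_restrict_le {A B : Type u} {t t' : Fin 2} {e : A ↪ B}
    {E : family t A V →ₗ[k] family t' B V} {R : family t' B V →ₗ[k] family t A V}
    (hE : ∀ x a, coord t' (E x) (e a) = coord t x a) (hR : ∀ x a, coord t (R x) a = coord t' x (e a))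
    (hE0 : ∀ x, ∀ b ∉ range e, coord t' (E x) b = 0) (y : family t' B V) {C : ℝ} (hC : 0 ≤ C)
    (h : ∀ b ∉ range e, ‖coord t' y b‖ ≤ C) : ‖y - E (R y)‖ ≤ C := by
  refine norm_le_of_coord_le hC fun b => ?_
  rw [map_sub, Pi.sub_apply]
  by_cases hb : b ∈ range e
  · obtain ⟨a, rfl⟩ := hb
    rw [hE, hR, sub_self, norm_zero]
    exact hC
  · rw [hE0 _ b hb, sub_zero]
    exact h b hb

/-- If `C₀(I, V)` is a retract of `ℓ^∞(I, W)`, or vice versa, it is a retract of a finite power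
of `W`. -/
theorem exists_isRetract_finite_power (hk : DenseRange (fun x : k => ‖x‖₊)) [Infinite I]
    (hI : ∀ F : Ultrafilter I, CountableInterFilter (F : Filter I) → ∃ a, F = pure a)
    {t t' : Fin 2} (ht : t ≠ t') (h : IsRetract (family t I V) (family t' I W)) (t'' : Fin 2) :
    ∃ T : Finset I, IsRetract (family t I V) (family t'' T W) := by
  obtain ⟨s, r, hs, hr, hrs⟩ := h
  have hsub (F : Finset I) : range (Function.Embedding.subtype (· ∈ F)) = F := by
    ext; simp
  -- `e` re-embeds `I` away from `F`, and `E' ∘ R'` keeps only the coordinates in `T`. The displayed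
  -- quantity is the deviation from the identity when `s` and `r` are routed through the finite
  -- power.
  suffices ∃ (F T : Finset I) (δ : ℝ), δ < 1 ∧ ∀ e : I ↪ I, (∀ i, e i ∉ F) →
      ∀ (E : family t I V →ₗ[k] family t I V) (R : family t I V →ₗ[k] family t I V)
        (E' : family t'' T W →ₗ[k] family t' I W) (R' : family t' I W →ₗ[k] family t'' T W),
        (∀ x, ‖E x‖ ≤ ‖x‖) → (∀ x, ∀ b ∉ range e, coord t (E x) b = 0) →
        (∀ x, ‖R x‖ ≤ ‖x‖) → (∀ x a, coord t (R x) a = coord t x (e a)) →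
        (∀ x a, coord t' (E' x) (Function.Embedding.subtype (· ∈ T) a) = coord t'' x a) →
        (∀ x, ∀ b ∉ (T : Set I), coord t' (E' x) b = 0) →
        (∀ x a, coord t'' (R' x) a = coord t' x (Function.Embedding.subtype (· ∈ T) a)) →
        ∀ x, ‖R (r (s (E x) - E' (R' (s (E x)))))‖ ≤ δ * ‖x‖ by
    obtain ⟨F, T, δ, hδ, H⟩ := this
    obtain ⟨e, he⟩ := exists_embedding_avoiding F
    obtain ⟨E, hE, hEc, hE0⟩ := exists_extend (V := V) (t := t) (t' := t) e (Or.inl rfl)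
    obtain ⟨R, hR, hRc⟩ := exists_restrict (V := V) (t := t) (t' := t) e (Or.inl rfl)
    obtain ⟨E', hE', hEc', hE0'⟩ := exists_extend (V := W) (t := t'') (t' := t')
      (Function.Embedding.subtype (· ∈ T)) (Or.inr inferInstance)
    obtain ⟨R', hR', hRc'⟩ := exists_restrict (V := W) (t := t') (t' := t'')
      (Function.Embedding.subtype (· ∈ T)) (Or.inr inferInstance)
    rw [hsub] at hE0'
    have hRE (x) : R (E x) = x := coord_injective t (by ext a; rw [hRc, hEc])
    refine ⟨T, isRetract_of_norm_sub_le (R' ∘ₗ s ∘ₗ E) (R ∘ₗ r ∘ₗ E')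
      (fun x => (hR' _).trans ((hs _).trans (hE x))) (fun y => (hR _).trans ((hr _).trans (hE' y)))
      hδ fun x => ?_⟩
    have := H e he E R E' R' hE hE0 hR hRc hEc' hE0' hRc' x
    rwa [map_sub, map_sub, hrs, hRE] at this
  match t, t' with
  | 0, 0 => exact absurd rfl ht
  | 1, 1 => exact absurd rfl ht
  | 1, 0 =>
    -- Here `r` goes from `ℓ^∞` to `C₀`: the exceptional source coordinates are kept in the finite
    -- power, and the target ones are avoided by `e`.
    obtain ⟨F, J, δ, hδ0, hδ, h⟩ := exists_strictly_contractive_cofinite hk hI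
      ((coord 1).comp r) (fun x b => (norm_coord_le 1 _ b).trans (hr x))
      fun x => admissible_coord 1 (r x) 1 one_pos
    refine ⟨J, F, δ, hδ, fun e he E R E' R' hE hE0 hR hRc hEc' hE0' hRc' x => ?_⟩
    rw [← hsub] at hE0'
    refine norm_le_of_coord_le (mul_nonneg hδ0 (norm_nonneg x)) fun a => ?_
    rw [hRc]
    refine (h _ (fun b hb => ?_) (e a) (he a)).trans (mul_le_mul_of_nonneg_left ?_ hδ0)
    · have h1 := hEc' (R' (s (E x))) ⟨b, hb⟩
      rw [hRc'] at h1
      rw [map_sub, Pi.sub_apply, sub_eq_zero]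
      exact h1.symm
    · exact (norm_sub_extend_restrict_le hEc' hRc' hE0' (s (E x)) (norm_nonneg _)
        fun b _ => norm_coord_le 0 _ b).trans ((hs _).trans (hE x))
  | 0, 1 =>
    -- Now `s` goes from `ℓ^∞` to `C₀`, and the two exceptional sets swap roles.
    obtain ⟨F, J, δ, hδ0, hδ, h⟩ := exists_strictly_contractive_cofinite hk hI
      ((coord 1).comp s) (fun x b => (norm_coord_le 1 _ b).trans (hs x))
      fun x => admissible_coord 1 (s x) 1 one_pos
    refine ⟨F, J, δ, hδ, fun e he E R E' R' hE hE0 hR hRc hEc' hE0' hRc' x => ?_⟩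
    rw [← hsub] at hE0'
    refine ((hR _).trans (hr _)).trans (norm_sub_extend_restrict_le hEc' hRc' hE0' (s (E x))
      (mul_nonneg hδ0 (norm_nonneg x)) fun b hb => ?_)
    rw [hsub] at hb
    refine (h (E x) (fun a ha => hE0 x a ?_) b hb).trans (mul_le_mul_of_nonneg_left (hE x) hδ0)
    rintro ⟨i, rfl⟩
    exact he i ha

theorem one_sub_ne_self_fin_two : ∀ t : Fin 2, 1 - t ≠ t := by decide

theorem one_sub_eq_of_ne_fin_two : ∀ {t t' : Fin 2}, t ≠ t' → 1 - t' = t := by decide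

theorem alternating_succ [IsUltrametricDist k] [CompleteSpace k] (t : Fin 2) (n : ℕ) :
    alternating k I t (n + 1) = family t I (alternating k I (1 - t) n) := by
  match t with
  | 0 => rfl
  | 1 => rfl

/-- A dimension count: the unit families are infinitely many independent vectors. -/
theorem not_isRetract_power_zero [IsUltrametricDist k] [CompleteSpace k] [Infinite I]
    (t t' t₁ t₂ : Fin 2) (T : Type u) [Finite T] :
    ¬ IsRetract (family t I (alternating k I t₁ 0)) (family t' T (alternating k I t₂ 0)) := by
  classical
  rintro ⟨s, r, -, -, hrs⟩
  have hs : Function.Injective s := Function.LeftInverse.injective hrs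
  have key (t : Fin 2) : ∃ e : alternating k I t 0 ≃ₗ[k] k, True := by
    match t with
    | 0 => exact ⟨LinearEquiv.refl k k, trivial⟩
    | 1 => exact ⟨LinearEquiv.refl k k, trivial⟩
  obtain ⟨e₁, -⟩ := key t₁
  obtain ⟨e₂, -⟩ := key t₂
  choose x hx using fun i : I => exists_coord_eq (t := t)
    (v := Pi.single (M := fun _ : I => (alternating k I t₁ 0 : Type u)) i (e₁.symm 1))
    (admissible_of_finite_support ((Set.finite_singleton i).subset fun j hj => by
      by_contra h
      exact hj (Pi.single_eq_of_ne h _)))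
  have hli : LinearIndependent k x := by
    refine LinearIndependent.of_comp (coord t) ?_
    rw [show coord t ∘ x = _ from funext hx]
    exact Pi.linearIndependent_single_of_ne_zero fun _ => e₁.symm.map_ne_zero_iff.2 one_ne_zero
  let f : family t I (alternating k I t₁ 0) →ₗ[k] (T → k) :=
    (LinearMap.compLeft e₂.toLinearMap T).comp ((coord t').comp s)
  have hf : Function.Injective f :=
    (e₂.injective.comp_left).comp ((coord_injective t').comp hs)
  have := (hli.map' f (LinearMap.ker_eq_bot.2 hf)).finite
  exact not_finite I

/-- In the inductive step the finite power is absorbed into `V_{t,n+1}`. Then `V_{1-t,n+1}`, a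
summand of `V_{t,n+2}`, is a retract of `V_{t,n+1}`; the types differ, so it is a retract of a
finite power of `V_{1-t,n}`, against the induction hypothesis for `1 - t`. -/
theorem not_isRetract_power [IsUltrametricDist k] [CompleteSpace k]
    (hk : DenseRange (fun x : k => ‖x‖₊)) [Infinite I]
    (hI : ∀ F : Ultrafilter I, CountableInterFilter (F : Filter I) → ∃ a, F = pure a)
    (n : ℕ) : ∀ (t : Fin 2) (T : Type u) [Finite T],
      ¬ IsRetract (alternating k I t (n + 1)) (family t T (alternating k I t n)) := by
  induction n with
  | zero =>
    intro t T _ h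
    rw [alternating_succ] at h
    exact not_isRetract_power_zero _ _ _ _ _ h
  | succ n ih =>
    intro t T _ h
    obtain ⟨e⟩ := exists_embedding_prod (I := I) T
    have ht' := one_sub_ne_self_fin_two t
    have ht := one_sub_eq_of_ne_fin_two ht'.symm
    rw [alternating_succ t n] at h
    have h1 : IsRetract (alternating k I t (n + 1 + 1)) (alternating k I t (n + 1)) := by
      rw [alternating_succ t n]
      exact h.trans (isRetract_family_prod.trans (isRetract_family_of_embedding e (Or.inl rfl)))
    have h2 : IsRetract (alternating k I (1 - t) (n + 1)) (alternating k I t (n + 1 + 1)) := by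
      rw [alternating_succ t (n + 1)]
      exact isRetract_family_self
    have h3 := h2.trans h1
    rw [alternating_succ (1 - t), alternating_succ t, ht] at h3
    obtain ⟨T', h4⟩ := exists_isRetract_finite_power hk hI ht' h3 (1 - t)
    refine ih (1 - t) T' ?_
    rwa [alternating_succ (1 - t), ht]

theorem not_isRetract_alternating [IsUltrametricDist k] [CompleteSpace k]
    (hk : DenseRange (fun x : k => ‖x‖₊)) [Infinite I]
    (hI : ∀ F : Ultrafilter I, CountableInterFilter (F : Filter I) → ∃ a, F = pure a)
    {n : ℕ} (hn : 0 < n) {t t' : Fin 2} (ht : t ≠ t') :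
    ¬ IsRetract (alternating k I t n) (alternating k I t' n) := by
  intro h
  obtain ⟨n, rfl⟩ := Nat.exists_eq_add_of_lt hn
  rw [Nat.zero_add] at h
  have h1 := one_sub_eq_of_ne_fin_two ht
  rw [alternating_succ t, alternating_succ t', h1] at h
  obtain ⟨T, h⟩ := exists_isRetract_finite_power hk hI ht h t
  rw [← alternating_succ t] at h
  exact not_isRetract_power hk hI n t T h

theorem isRetract_alternating_succ [IsUltrametricDist k] [CompleteSpace k] [Nonempty I] (n : ℕ) :
    ∀ t t' : Fin 2, IsRetract (alternating k I t n) (alternating k I t' (n + 1)) := by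
  induction n with
  | zero =>
    intro t t'
    have h : alternating k I t 0 = alternating k I (1 - t') 0 := by
      simp [alternating]
    rw [h, alternating_succ]
    exact isRetract_family_self
  | succ n ih =>
    intro t t'
    rcases eq_or_ne t t' with rfl | ht
    · rw [alternating_succ t n, alternating_succ t (n + 1)]
      exact (ih _ _).family
    · have h1 := one_sub_eq_of_ne_fin_two ht
      rw [alternating_succ t' (n + 1), h1]
      exact isRetract_family_self

theorem isRetract_alternating_of_lt [IsUltrametricDist k] [CompleteSpace k] [Nonempty I] {n n' : ℕ}
    (h : n < n') (t t' : Fin 2) : IsRetract (alternating k I t n) (alternating k I t' n') := by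
  induction n', h using Nat.le_induction with
  | base => exact isRetract_alternating_succ n t t'
  | succ m _ ih => exact ih.trans (isRetract_alternating_succ m t' t')

theorem alternating_iso_iff [IsUltrametricDist k] [CompleteSpace k]
    (hk : DenseRange (fun x : k => ‖x‖₊)) [Infinite I]
    (hI : ∀ F : Ultrafilter I, CountableInterFilter (F : Filter I) → ∃ a, F = pure a)
    {t t' : Fin 2} {n n' : ℕ} (hn : 0 < n) (hn' : 0 < n') :
    (alternating k I t n).Iso (alternating k I t' n') ↔ (t, n) = (t', n') := by
  refine ⟨fun h => ?_, fun h => ?_⟩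
  · have hlt : ∀ {t t' : Fin 2} {n n' : ℕ}, 0 < n → n < n' →
        ¬ (alternating k I t n).Iso (alternating k I t' n') := fun {t t' n n'} hn hnn h => by
      -- `V_{1-t,n}` is a retract of the higher space `V_{t',n'}`, hence of `V_{t,n}` at its own
      -- level.
      exact not_isRetract_alternating hk hI hn (one_sub_ne_self_fin_two t)
        ((isRetract_alternating_of_lt hnn _ _).trans h.symm.isRetract)
    rcases lt_trichotomy n n' with hnn | rfl | hnn
    · exact (hlt hn hnn h).elim
    · by_contra hne
      exact not_isRetract_alternating hk hI hn (fun ht => hne (by rw [ht])) h.isRetract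
    · exact (hlt hn' hnn h.symm).elim
  · obtain ⟨rfl, rfl⟩ := Prod.mk.inj h
    exact ⟨LinearIsometryEquiv.refl k _⟩

end Alternating

end BanachSpace

theorem mainTheorem4 (k : Type u) [NormedField k] [IsUltrametricDist k] [CompleteSpace k]
    (hk : DenseRange (fun x : k => ‖x‖₊)) :
    (∀ κ : WithTop Cardinal.{u}, ((ℵ₀ : Cardinal.{u}) : WithTop Cardinal.{u}) ≤ κ →
      NonMeasurabilityCondition κ →
      ∀ c : Cardinal.{u}, ℵ₀ ≤ c → (c : WithTop Cardinal.{u}) < κ →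
      ∀ I : Type u, #I = c →
      ∀ (t t' : Fin 2) (n n' : ℕ), 0 < n → 0 < n' →
        ((BanachSpace.alternating k I t n).Iso (BanachSpace.alternating k I t' n') ↔
          (t, n) = (t', n'))) ∧
    (∀ I : Type u, #I = ℵ₀ →
      ∀ (t t' : Fin 2) (n n' : ℕ), 0 < n → 0 < n' →
        ((BanachSpace.alternating k I t n).Iso (BanachSpace.alternating k I t' n') ↔
          (t, n) = (t', n'))) := by
  refine ⟨fun κ _ hκ c hc hcκ I hI t t' n n' hn hn' => ?_, fun I hI t t' n n' hn hn' => ?_⟩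
  · subst hI
    have := infinite_iff.2 hc
    exact BanachSpace.alternating_iso_iff hk
      (ultrafilter_eq_pure_of_not_isMeasurableSet (hκ I hcκ)) hn hn'
  · have := infinite_iff.2 hI.ge
    have hcount : Countable I := mk_le_aleph0_iff.1 hI.le
    exact BanachSpace.alternating_iso_iff hk
      (ultrafilter_eq_pure_of_not_isMeasurableSet fun h => not_countable_iff.2 h.1 hcount) hn hn'
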